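/- Let $K$ be a field. For an integer matrix $A\in\mathbb Z^{m\times n}$ with $\operatorname{Ker}_{\mathbb Z}(A)\cap\mathbb N^n=\{\mathbf 0\}$, let $I_A=\langle x^{\mathbf u^+}-x^{\mathbf u^-}:\mathbf u\in\operatorname{Ker}_{\mathbb Z}(A)\rangle\subset K[x_1,\dots,x_n]$ be its toric ideal, let $\operatorname{Gr}(A)$ be the set of nonzero $\mathbf u\in\operatorname{Ker}_{\mathbb Z}(A)$ that cannot be written as $\mathbf u=\mathbf v+\mathbf w$ with nonzero $\mathbf v,\mathbf w\in\operatorname{Ker}_{\mathbb Z}(A)$, $\mathbf u^+=\mathbf v^++\mathbf w^+$ and $\mathbf u^-=\mathbf v^-+\mathbf w^-$, and let $S(A)$ be the set of nonzero $\mathbf u\in\operatorname{Ker}_{\mathbb Z}(A)$ that cannot be written as $\mathbf u=\mathbf v+\mathbf w$ with nonzero $\mathbf v,\mathbf w\in\operatorname{Ker}_{\mathbb Z}(A)$ such that, for every $i$, $v_i>0$ implies $w_i\ge 0$ and $w_i<0$ implies $v_i\le 0$. The ideal $I_A$ is strongly robust if its Graver basis $\{x^{\mathbf u^+}-x^{\mathbf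 u^-}:\mathbf u\in\operatorname{Gr}(A)\}$ (with opposite binomials identified) is a minimal system of generators of $I_A$. Let $G(\mathbf a_1),\dots,G(\mathbf a_n)$ be the rows of a matrix whose columns form a $\mathbb Z$-basis of $\operatorname{Ker}_{\mathbb Z}(A)$. The bouquets $B_1,\dots,B_s$ of $A$ are the connected components of the graph on the columns $\mathbf a_1,\dots,\mathbf a_n$ of $A$ in which two columns are joined if $G(\mathbf a_i)$ and $G(\mathbf a_j)$ are rational multiples of each other. The columns with $G(\mathbf a_i)=\mathbf 0$, if any, form the free bouquet. A non-free bouquet is mixed if it has an edge with $G(\mathbf a_i)=\lambda G(\mathbf a_j)$, $\lambda<0$, and non-mixed otherwise. Order the columns $\mathbf a_{j1},\dots,\mathbf a_{jk_j}$ of each bouquet $B_j$. If $B_j$ is not free, choose a coordinate $l$ in which the vectors $G(\mathbf a_{j1}),\dots,G(\mathbf a_{jk_j})$ are all nonzero, and put $c^B_{ja}=\varepsilon\, G(\mathbf a_{ja})_l/\gcd_b G(\mathbf a_{jb})_l$, where $\varepsilon$ is the sign of $G(\mathbf a_{j1})_l$; if $B_j$ is free, let the $c^B_{ja}$ be any nonzero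 integers with $c^B_{j1}>0$. The bouquet ideal of $I_A$ is the toric ideal of the matrix $A_B$ with columns $\sum_a c^B_{ja}\mathbf a_{ja}$, $1\le j\le s$, and $D$ is the linear map with $D(\mathbf u)_{ja}=c^B_{ja}u_j$. For a toric ideal $I_T\subset K[x_1,\dots,x_s]$ all of whose bouquets are singletons and for $\omega\subseteq\{1,\dots,s\}$, a toric ideal $I_A$ is $T_\omega$-robust if its bouquet ideal is $I_T$ and $\omega=\{j: B_j\text{ is non-mixed}\}$. The strongly robust complex $\Delta_T$ is the set of all $\omega$ such that $\{\mathbf u\in\operatorname{Gr}(T): D(\mathbf u)\in S(A)\}=\operatorname{Gr}(T)$ for a $T_\omega$-robust toric ideal $I_A$ (this does not depend on the choice of $I_A$). **Theorem.** Let $A\in\mathbb Z^{m\times n}$ with $\operatorname{Ker}_{\mathbb Z}(A)\cap\mathbb N^n=\{\mathbf 0\}$ be such that $I_A$ is strongly robust and its bouquet ideal is the ideal $I_T$ of a monomial curve, where $T=(n_1,\dots,n_s)\in\mathbb Z^{1\times s}$, $s\ge 3$ and $\operatorname{Ker}_{\mathbb Z}(T)\cap\mathbb N^s=\{\mathbf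 0\}$. Then there are integers $m_j\ge1$ with $\sum_j m_j=n$, integer vectors $\mathbf c_j=(c_{j1},\dots,c_{jm_j})\in\mathbb Z^{m_j}$ with full support and with the greatest common divisor of their components equal to $1$, and integers $\lambda_{ja}$ with $\sum_a\lambda_{ja}c_{ja}=1$, for $j=1,\dots,s$, such that, up to a permutation of the column indices, $I_A=I_{A'}$ for the generalized Lawrence matrix $$A'=\begin{pmatrix}A_1&A_2&\cdots&A_s\\ C_1&0&\cdots&0\\ 0&C_2&\cdots&0\\ \vdots&\vdots&\ddots&\vdots\\ 0&0&\cdots&C_s\end{pmatrix},\qquad A_j=(\lambda_{j1}n_j,\dots,\lambda_{jm_j}n_j),\qquad C_j=\begin{pmatrix}-c_{j2}&c_{j1}&&\\ \vdots&&\ddots&\\ -c_{jm_j}&&&c_{j1}\end{pmatrix}\in\mathbb Z^{(m_j-1)\times m_j}.$$ Every $\mathbf c_j$ has a positive first component, and either $\Delta_T=\{\emptyset\}$ and every $\mathbf c_j$ has a negative component, or $\Delta_T=\{\emptyset,\{i\}\}$ for some $i$ and every $\mathbf c_j$ with $j\ne i$ has a negative component (while all components of $\mathbf c_i$ may be positive).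 -/

import Mathlib

namespace ToricBouquet

open Finset

/-- `Ker_ℤ(A) ∩ ℕⁿ = {0}`: the standing assumption on matrices that define toric ideals. -/
def PointedKernel {ι κ : Type*} [Fintype κ] (A : Matrix ι κ ℤ) : Prop :=
  ∀ u : κ → ℤ, A.mulVec u = 0 → (∀ i, 0 ≤ u i) → u = 0

/-- The binomial `x^{u⁺} - x^{u⁻}`. -/
noncomputable def binomial (K : Type*) [Field K] {κ : Type*} [Fintype κ] (u : κ → ℤ) :
    MvPolynomial κ K :=
  ∏ i, MvPolynomial.X i ^ (u i).toNat - ∏ i, MvPolynomial.X i ^ (-u i).toNat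

/-- The toric ideal `I_A`. -/
noncomputable def toricIdeal (K : Type*) [Field K] {ι κ : Type*} [Fintype κ]
    (A : Matrix ι κ ℤ) : Ideal (MvPolynomial κ K) :=
  Ideal.span {f | ∃ u : κ → ℤ, A.mulVec u = 0 ∧ f = binomial K u}

/-- `v + w` is a conformal sum: `(v+w)⁺ = v⁺ + w⁺` and `(v+w)⁻ = v⁻ + w⁻`. -/
def IsConformal {κ : Type*} (v w : κ → ℤ) : Prop :=
  ∀ i, (v i + w i)⁺ = (v i)⁺ + (w i)⁺ ∧ (v i + w i)⁻ = (v i)⁻ + (w i)⁻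

/-- `v + w` is a semiconformal sum (the order of the summands matters). -/
def IsSemiconformal {κ : Type*} (v w : κ → ℤ) : Prop :=
  ∀ i, (0 < v i → 0 ≤ w i) ∧ (w i < 0 → v i ≤ 0)

/-- `Gr(A)`: nonzero kernel vectors without a proper conformal decomposition. -/
def graver {ι κ : Type*} [Fintype κ] (A : Matrix ι κ ℤ) : Set (κ → ℤ) :=
  {u | A.mulVec u = 0 ∧ u ≠ 0 ∧ ¬ ∃ v w : κ → ℤ, A.mulVec v = 0 ∧ A.mulVec w = 0 ∧
    v ≠ 0 ∧ w ≠ 0 ∧ u = v + w ∧ IsConformal v w}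

/-- `S(A)`: nonzero kernel vectors without a proper semiconformal decomposition. -/
def indispensable {ι κ : Type*} [Fintype κ] (A : Matrix ι κ ℤ) : Set (κ → ℤ) :=
  {u | A.mulVec u = 0 ∧ u ≠ 0 ∧ ¬ ∃ v w : κ → ℤ, A.mulVec v = 0 ∧ A.mulVec w = 0 ∧
    v ≠ 0 ∧ w ≠ 0 ∧ u = v + w ∧ IsSemiconformal v w}

/-- The Graver basis of `I_A` is a minimal system of generators of `I_A`. Opposite binomials
(those of `u` and `-u`) are identified, so both are removed in the minimality clause. -/
def IsStronglyRobust (K : Type*) [Field K] {ι κ : Type*} [Fintype κ]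
    (A : Matrix ι κ ℤ) : Prop :=
  Ideal.span {f | ∃ u ∈ graver A, f = binomial K u} = toricIdeal K A ∧
  ∀ u ∈ graver A,
    Ideal.span {f | ∃ v ∈ graver A, v ≠ u ∧ v ≠ -u ∧ f = binomial K v} ≠ toricIdeal K A

/-- The columns of `G` form a `ℤ`-basis of the lattice `Ker_ℤ(A)`; the rows of `G` are the
vectors `G(a_1), …, G(a_n)`. -/
def IsGaleTransform {m n d : ℕ} (A : Matrix (Fin m) (Fin n) ℤ)
    (G : Matrix (Fin n) (Fin d) ℤ) : Prop :=
  LinearIndependent ℤ (fun l : Fin d => G.transpose l) ∧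
  Submodule.span ℤ (Set.range fun l : Fin d => G.transpose l) = LinearMap.ker A.mulVecLin

/-- The vector `x` equals `q` times the vector `y`. -/
def IsMultiple {d : ℕ} (q : ℚ) (x y : Fin d → ℤ) : Prop :=
  ∀ l, (x l : ℚ) = q * (y l : ℚ)

/-- The bouquet graph; the column `a_i` is represented by its index `i`. -/
def bouquetGraph {n d : ℕ} (G : Matrix (Fin n) (Fin d) ℤ) : SimpleGraph (Fin n) where
  Adj i j := i ≠ j ∧ (∃ q : ℚ, IsMultiple q (G i) (G j)) ∧ (∃ q : ℚ, IsMultiple q (G j) (G i))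
  symm := ⟨fun _ _ h => ⟨h.1.symm, h.2.2, h.2.1⟩⟩
  loopless := ⟨fun _ h => h.1 rfl⟩

/-- The choices that enter the construction of the bouquet ideal of `A` when `A` has `s`
bouquets: a Gale transform, an enumeration `B_1, …, B_s` of the bouquets (the connected
components of the bouquet graph) with an ordering `e ⟨j, 0⟩, …, e ⟨j, r j⟩` of the columns in
`B_j`, and the vectors `c_{B_j}`, of which only the coordinates in `B_j` are recorded. -/
structure BouquetData {m n : ℕ} (A : Matrix (Fin m) (Fin n) ℤ) (s : ℕ) where
  d : ℕ
  G : Matrix (Fin n) (Fin d) ℤ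
  isGale : IsGaleTransform A G
  r : Fin s → ℕ
  e : (Σ j : Fin s, Fin (r j + 1)) ≃ Fin n
  reachable_iff : ∀ p q, (bouquetGraph G).Reachable (e p) (e q) ↔ p.1 = q.1
  c : ∀ j : Fin s, Fin (r j + 1) → ℤ
  c_free : ∀ j, (∀ a, G (e ⟨j, a⟩) = 0) → 0 < c j 0 ∧ ∀ a, c j a ≠ 0
  c_nonfree : ∀ j, ¬ (∀ a, G (e ⟨j, a⟩) = 0) →
    ∃ l : Fin d, (∀ a, G (e ⟨j, a⟩) l ≠ 0) ∧
      ∀ a, c j a = (G (e ⟨j, 0⟩) l).sign *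
        (G (e ⟨j, a⟩) l / univ.gcd fun b => G (e ⟨j, b⟩) l)

namespace BouquetData

variable {m n s : ℕ} {A : Matrix (Fin m) (Fin n) ℤ}

/-- The `j`-th bouquet is the free bouquet. -/
def IsFree (B : BouquetData A s) (j : Fin s) : Prop :=
  ∀ a, B.G (B.e ⟨j, a⟩) = 0

/-- The `j`-th bouquet is non-mixed: it is not free and all its edges have a positive ratio
(in particular this holds if it is not free and is an isolated vertex). -/
def IsNonMixed (B : BouquetData A s) (j : Fin s) : Prop :=
  ¬ B.IsFree j ∧ ∀ a b, (bouquetGraph B.G).Adj (B.e ⟨j, a⟩) (B.e ⟨j, b⟩) →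
    ∃ q : ℚ, 0 < q ∧ IsMultiple q (B.G (B.e ⟨j, a⟩)) (B.G (B.e ⟨j, b⟩))

/-- The matrix `A_B` with columns `a_{B_j} = ∑ a, c_{j a} • a_{j a}`. -/
def bouquetMatrix (B : BouquetData A s) : Matrix (Fin m) (Fin s) ℤ :=
  Matrix.of fun i j => ∑ a, B.c j a * A i (B.e ⟨j, a⟩)

/-- The linear map `D`, `D(u)_{j a} = c_{j a} u_j`. -/
def D (B : BouquetData A s) (u : Fin s → ℤ) : Fin n → ℤ :=
  fun i => B.c (B.e.symm i).1 (B.e.symm i).2 * u (B.e.symm i).1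

end BouquetData

/-- The bouquet ideal of `I_A` is `I_T`. -/
def HasBouquetIdeal (K : Type*) [Field K] {m n t s : ℕ} (A : Matrix (Fin m) (Fin n) ℤ)
    (T : Matrix (Fin t) (Fin s) ℤ) : Prop :=
  ∃ B : BouquetData A s, toricIdeal K B.bouquetMatrix = toricIdeal K T

/-- `I_A`, with bouquets labelled as in `B`, is a `T_ω`-robust toric ideal. -/
def IsTRobust (K : Type*) [Field K] {m n t s : ℕ} (T : Matrix (Fin t) (Fin s) ℤ)
    (ω : Set (Fin s)) (A : Matrix (Fin m) (Fin n) ℤ) (B : BouquetData A s) : Prop :=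
  PointedKernel A ∧ toricIdeal K B.bouquetMatrix = toricIdeal K T ∧ ω = {j | B.IsNonMixed j}

/-- The `T_ω`-indispensable set, computed in the `T_ω`-robust ideal `I_A`. -/
def tIndispensable {m n t s : ℕ} (T : Matrix (Fin t) (Fin s) ℤ)
    (A : Matrix (Fin m) (Fin n) ℤ) (B : BouquetData A s) : Set (Fin s → ℤ) :=
  {u | u ∈ graver T ∧ B.D u ∈ indispensable A}

/-- The strongly robust complex `Δ_T` of a simple toric ideal `I_T`: the sets `ω` with
`S_ω(T) = Gr(T)`. -/
def stronglyRobustComplex (K : Type*) [Field K] {t s : ℕ} (T : Matrix (Fin t) (Fin s) ℤ) :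
    Set (Set (Fin s)) :=
  {ω | ∃ (m n : ℕ) (A : Matrix (Fin m) (Fin n) ℤ) (B : BouquetData A s),
    IsTRobust K T ω A B ∧ tIndispensable T A B = graver T}

/-- The matrix `C(c_1, …, c_{r+1})`, of size `r × (r+1)`. -/
def lawrenceC {r : ℕ} (c : Fin (r + 1) → ℤ) : Matrix (Fin r) (Fin (r + 1)) ℤ :=
  Matrix.of fun a b => if b = 0 then -c a.succ else if b = a.succ then c 0 else 0

/-- The generalized Lawrence matrix: the top row is `(A_1 | ⋯ | A_s)` with
`A_j = (lam_{j1} n_j, …, lam_{jm_j} n_j)`, and below it is the block diagonal matrix with blocks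
`C_j = C(c_j)`. Here `m_j = r j + 1`, and `T = (n_1, …, n_s)`. -/
def generalizedLawrence {s : ℕ} {r : Fin s → ℕ} (T : Matrix (Fin 1) (Fin s) ℤ)
    (c lam : ∀ j : Fin s, Fin (r j + 1) → ℤ) :
    Matrix (Fin 1 ⊕ Σ j : Fin s, Fin (r j)) (Σ j : Fin s, Fin (r j + 1)) ℤ :=
  Matrix.fromRows (Matrix.of fun i p => lam p.1 p.2 * T i p.1)
    (Matrix.blockDiagonal' fun j => lawrenceC (c j))

end ToricBouquet

/-! A toric ideal and the integer kernel of its matrix determine each other, so everything reduces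
to lattices. In a Gale transform the rows of a bouquet are proportional to the vector `c j`, hence
`D` maps Ker(A_B) = Ker(T) bijectively onto Ker(A) once no bouquet is free. The kernel of the
generalized Lawrence matrix built from T and the same `c j` is this same image, which gives the
equality of ideals.

For the signs, strong robustness forces Gr(A) ⊆ S(A): a semiconformal splitting of a Graver vector
would make its binomial redundant. Since `D` maps Gr(T) into Gr(A), the set of non-mixed bouquets of
A is a face of Δ_T, and a bouquet is non-mixed exactly when its `c j` is positive.

It remains to see that Δ_T has at most one vertex. Replace T by a row of positive integers N with
the same kernel. If i lies in a face, then for any other distinct j, k the circuit on {j, k} must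
not split off the circuit on {i, j}, which forces lcm(N_j, N_k) < lcm(N_i, N_j). Two vertices i, j
and a third index k would give lcm(N_j, N_k) < lcm(N_i, N_k) and the reverse inequality. Finally, ∅
is a face because on a Lawrence lifting semiconformal sums are conformal. -/

namespace ToricBouquet

/-! ### Toric ideals, kernels and redundant Graver binomials -/

section Ideals

variable {K : Type*} [Field K] {ι ι' κ : Type*} [Fintype κ]

theorem toricIdeal_congr {A : Matrix ι κ ℤ} {A' : Matrix ι' κ ℤ}
    (h : ∀ u, A.mulVec u = 0 ↔ A'.mulVec u = 0) : toricIdeal K A = toricIdeal K A' := by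
  simp only [toricIdeal, h]

/-- The monomial map `x_i ↦ t^{a_i}`, with `a_i` the columns of `A`. -/
noncomputable def monomialMap (K : Type*) [Field K] (A : Matrix ι κ ℤ) :
    MvPolynomial κ K →ₐ[K] AddMonoidAlgebra K (ι → ℤ) :=
  MvPolynomial.aeval fun i => AddMonoidAlgebra.of K (ι → ℤ) (Multiplicative.ofAdd (A.col i))

theorem monomialMap_prod (A : Matrix ι κ ℤ) (f : κ → ℕ) :
    monomialMap K A (∏ i, MvPolynomial.X i ^ f i) =
      AddMonoidAlgebra.of K (ι → ℤ)
        (Multiplicative.ofAdd (A.mulVec fun i => (f i : ℤ))) := by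
  have h : (A.mulVec fun i => (f i : ℤ)) = ∑ i, f i • A.col i := by
    ext k
    simp [Matrix.mulVec, dotProduct, Matrix.col, mul_comm]
  rw [h, ofAdd_sum, map_prod, map_prod]
  refine Finset.prod_congr rfl fun i _ => ?_
  rw [ofAdd_nsmul, map_pow, map_pow, monomialMap, MvPolynomial.aeval_X]

theorem monomialMap_binomial_eq_zero_iff (A : Matrix ι κ ℤ) (u : κ → ℤ) :
    monomialMap K A (binomial K u) = 0 ↔ A.mulVec u = 0 := by
  rw [binomial, map_sub, monomialMap_prod, monomialMap_prod, sub_eq_zero,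
    AddMonoidAlgebra.of_injective.eq_iff, Multiplicative.ofAdd.injective.eq_iff,
    ← sub_eq_zero, ← Matrix.mulVec_sub]
  have : ((fun i => ((u i).toNat : ℤ)) - fun i => ((-u i).toNat : ℤ)) = u := by
    ext i
    simp only [Pi.sub_apply]
    omega
  rw [this]

/-- The ideal lies in the kernel of x_i ↦ t^{a_i}, and that map kills x^{u⁺} - x^{u⁻} only if Au⁺ =
Au⁻. Thus the ideal recovers the kernel lattice. -/
theorem binomial_mem_toricIdeal_iff (A : Matrix ι κ ℤ) (u : κ → ℤ) :
    binomial K u ∈ toricIdeal K A ↔ A.mulVec u = 0 := by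
  refine ⟨fun h => ?_, fun h => Ideal.subset_span ⟨u, h, rfl⟩⟩
  have hle : toricIdeal K A ≤ RingHom.ker (monomialMap K A) := by
    refine Ideal.span_le.2 ?_
    rintro f ⟨v, hv, rfl⟩
    exact (monomialMap_binomial_eq_zero_iff A v).2 hv
  exact (monomialMap_binomial_eq_zero_iff A u).1 (hle h)

theorem mulVec_eq_zero_iff_of_toricIdeal_eq {A : Matrix ι κ ℤ} {A' : Matrix ι' κ ℤ}
    (h : toricIdeal K A = toricIdeal K A') (u : κ → ℤ) :
    A.mulVec u = 0 ↔ A'.mulVec u = 0 := by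
  rw [← binomial_mem_toricIdeal_iff (K := K), h, binomial_mem_toricIdeal_iff]

theorem IsConformal.isSemiconformal {κ : Type*} {v w : κ → ℤ} (h : IsConformal v w) :
    IsSemiconformal v w := by
  intro i
  have := h i
  simp only [posPart_def, negPart_def] at this
  omega

/-- Semiconformality means v⁺ ≤ (v+w)⁺ and w⁻ ≤ (v+w)⁻, so both binomials can be multiplied up by
monomials; the two middle terms then agree and cancel. -/
theorem IsSemiconformal.binomial_add_mem {v w : κ → ℤ} (h : IsSemiconformal v w)
    {J : Ideal (MvPolynomial κ K)} (hv : binomial K v ∈ J) (hw : binomial K w ∈ J) :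
    binomial K (v + w) ∈ J := by
  have key : binomial K (v + w) =
      (∏ i, MvPolynomial.X i ^ ((v i + w i).toNat - (v i).toNat)) * binomial K v +
      (∏ i, MvPolynomial.X i ^ ((-(v i + w i)).toNat - (-w i).toNat)) * binomial K w := by
    simp only [binomial, mul_sub, ← Finset.prod_mul_distrib, ← pow_add, Pi.add_apply]
    have e1 : ∀ i, (v i + w i).toNat - (v i).toNat + (v i).toNat = (v i + w i).toNat := by
      intro i; have := h i; omega
    have e2 : ∀ i, (-(v i + w i)).toNat - (-w i).toNat + (-w i).toNat =
        (-(v i + w i)).toNat := by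
      intro i; have := h i; omega
    have e3 : ∀ i, (-(v i + w i)).toNat - (-w i).toNat + (w i).toNat =
        (v i + w i).toNat - (v i).toNat + (-v i).toNat := by
      intro i; have := h i; omega
    simp only [e1, e2, e3]
    ring
  rw [key]
  exact J.add_mem (J.mul_mem_left _ hv) (J.mul_mem_left _ hw)

/-- The binomial of a kernel vector `v` lies in every ideal that contains the binomials of the
Graver elements conformal to `v`. -/
theorem binomial_mem_of_graver (A : Matrix ι κ ℤ) (J : Ideal (MvPolynomial κ K)) (v : κ → ℤ)
    (hv : A.mulVec v = 0)
    (hJ : ∀ g ∈ graver A, (∀ i, (g i)⁺ ≤ (v i)⁺ ∧ (g i)⁻ ≤ (v i)⁻) → binomial K g ∈ J) :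
    binomial K v ∈ J := by
  -- The ℓ¹-norm is additive on conformal sums, so both summands are smaller.
  induction hN : ∑ i, (v i).natAbs using Nat.strong_induction_on generalizing v with
  | _ N ih =>
  by_cases h0 : v = 0
  · subst h0
    simp [binomial]
  by_cases hg : v ∈ graver A
  · exact hJ v hg fun i => ⟨le_rfl, le_rfl⟩
  have : ∃ x y : κ → ℤ, A.mulVec x = 0 ∧ A.mulVec y = 0 ∧
      x ≠ 0 ∧ y ≠ 0 ∧ v = x + y ∧ IsConformal x y := by
    by_contra hcon
    exact hg ⟨hv, h0, hcon⟩
  obtain ⟨x, y, hx, hy, hx0, hy0, rfl, hxy⟩ := this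
  have hsum : ∑ i, ((x + y) i).natAbs = ∑ i, (x i).natAbs + ∑ i, (y i).natAbs := by
    rw [← Finset.sum_add_distrib]
    refine Finset.sum_congr rfl fun i _ => ?_
    have := hxy i
    simp only [posPart_def, negPart_def] at this
    simp only [Pi.add_apply]
    omega
  have hpos : ∀ z : κ → ℤ, z ≠ 0 → 0 < ∑ i, (z i).natAbs := by
    intro z hz
    obtain ⟨i, hi⟩ := Function.ne_iff.1 hz
    exact Finset.sum_pos' (fun _ _ => Nat.zero_le _) ⟨i, Finset.mem_univ i, Int.natAbs_pos.2 hi⟩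
  have px := hpos x hx0
  have py := hpos y hy0
  refine hxy.isSemiconformal.binomial_add_mem (ih _ ?_ x hx ?_ rfl) (ih _ ?_ y hy ?_ rfl)
  · omega
  · refine fun g hg hgx => hJ g hg fun i => ?_
    have h1 := hxy i
    have h2 := hgx i
    simp only [posPart_def, negPart_def, Pi.add_apply] at *
    omega
  · omega
  · refine fun g hg hgy => hJ g hg fun i => ?_
    have h1 := hxy i
    have h2 := hgy i
    simp only [posPart_def, negPart_def, Pi.add_apply] at *
    omega

/-- If a Graver vector u were a proper semiconformal sum v + w, its binomial would come from Graver
vectors conformal to v or to w. None of these is ±u: that would give v or w a constant sign, hence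
make it zero by pointedness. So the pair ±u could be dropped from the generators. -/
theorem IsStronglyRobust.graver_subset_indispensable {A : Matrix ι κ ℤ}
    (hA : PointedKernel A) (h : IsStronglyRobust K A) : graver A ⊆ indispensable A := by
  intro u hu
  refine ⟨hu.1, hu.2.1, ?_⟩
  rintro ⟨v, w, hv, hw, hv0, hw0, rfl, hvw⟩
  refine h.2 _ hu ?_
  rw [← h.1]
  have hneg : ∀ x : κ → ℤ, A.mulVec x = 0 → (∀ i, x i ≤ 0) → x = 0 := by
    intro x hx hx'
    have := hA (-x) (by rw [Matrix.mulVec_neg, hx, neg_zero]) (fun i => by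
      have := hx' i
      simp only [Pi.neg_apply]
      omega)
    simpa using this
  refine le_antisymm (Ideal.span_mono ?_) (Ideal.span_le.2 ?_)
  · rintro f ⟨x, hx, -, -, rfl⟩
    exact ⟨x, hx, rfl⟩
  rintro f ⟨x, hx, rfl⟩
  have hmem : binomial K (v + w) ∈
      Ideal.span {f | ∃ x ∈ graver A, x ≠ v + w ∧ x ≠ -(v + w) ∧ f = binomial K x} := by
    refine hvw.binomial_add_mem (binomial_mem_of_graver A _ v hv ?_)
      (binomial_mem_of_graver A _ w hw ?_)
    · refine fun g hg hgv => Ideal.subset_span ⟨g, hg, ?_, ?_, rfl⟩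
      · rintro rfl
        refine hw0 (hA w hw fun i => ?_)
        have h1 := hvw i
        have h2 := hgv i
        simp only [posPart_def, negPart_def, Pi.add_apply] at h2
        omega
      · rintro rfl
        refine hv0 (hneg v hv fun i => ?_)
        have h1 := hvw i
        have h2 := hgv i
        simp only [posPart_def, negPart_def, Pi.add_apply, Pi.neg_apply] at h2
        omega
    · refine fun g hg hgw => Ideal.subset_span ⟨g, hg, ?_, ?_, rfl⟩
      · rintro rfl
        refine hv0 (hneg v hv fun i => ?_)
        have h1 := hvw i
        have h2 := hgw i
        simp only [posPart_def, negPart_def, Pi.add_apply] at h2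
        omega
      · rintro rfl
        refine hw0 (hA w hw fun i => ?_)
        have h1 := hvw i
        have h2 := hgw i
        simp only [posPart_def, negPart_def, Pi.add_apply, Pi.neg_apply] at h2
        omega
  by_cases h1 : x = v + w
  · rw [h1]
    exact hmem
  by_cases h2 : x = -(v + w)
  · have : binomial K x = -binomial K (v + w) := by
      rw [h2]
      simp [binomial]
    rw [SetLike.mem_coe, this]
    exact neg_mem hmem
  · exact Ideal.subset_span ⟨x, hx, h1, h2, rfl⟩

end Ideals


/-! ### The map that multiplies each coordinate by a block vector -/

section LawrenceMap

variable {n s : ℕ} {r : Fin s → ℕ}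

/-- The linear map `u ↦ (c_{ja} u_j)`, with the coordinates `(j, a)` labelled by `e`. -/
def lawrenceMap (e : (Σ j : Fin s, Fin (r j + 1)) ≃ Fin n) (c : ∀ j : Fin s, Fin (r j + 1) → ℤ) :
    (Fin s → ℤ) →ₗ[ℤ] (Fin n → ℤ) where
  toFun u i := c (e.symm i).1 (e.symm i).2 * u (e.symm i).1
  map_add' u v := by ext i; simp [mul_add]
  map_smul' q u := by ext i; simp [mul_left_comm]

variable (e : (Σ j : Fin s, Fin (r j + 1)) ≃ Fin n) (c : ∀ j : Fin s, Fin (r j + 1) → ℤ)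

@[simp]
theorem lawrenceMap_apply (u : Fin s → ℤ) (p : Σ j : Fin s, Fin (r j + 1)) :
    lawrenceMap e c u (e p) = c p.1 p.2 * u p.1 := by
  change c (e.symm (e p)).1 (e.symm (e p)).2 * u (e.symm (e p)).1 = _
  rw [e.symm_apply_apply]

theorem lawrenceMap_injective (hc : ∀ j, c j 0 ≠ 0) : Function.Injective (lawrenceMap e c) := by
  intro u v h
  ext j
  have := congrFun h (e ⟨j, 0⟩)
  simpa [hc j] using this

theorem exists_lawrenceMap_eq {lam : ∀ j : Fin s, Fin (r j + 1) → ℤ}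
    (hlam : ∀ j, ∑ a, lam j a * c j a = 1) (hc : ∀ j, c j 0 ≠ 0) (w : Fin n → ℤ)
    (hw : ∀ j a, c j 0 * w (e ⟨j, a⟩) = c j a * w (e ⟨j, 0⟩)) :
    ∃ u, lawrenceMap e c u = w := by
  -- Each block of `w` is a rational multiple of `c j`; the Bézout coefficients extract the factor
  -- and show that it is an integer.
  refine ⟨fun j => ∑ a, lam j a * w (e ⟨j, a⟩), ?_⟩
  ext i
  obtain ⟨⟨j, a⟩, rfl⟩ := e.surjective i
  rw [lawrenceMap_apply]
  have h : ∀ b, c j a * w (e ⟨j, b⟩) = c j b * w (e ⟨j, a⟩) := by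
    intro b
    apply mul_left_cancel₀ (hc j)
    linear_combination c j a * hw j b - c j b * hw j a
  simp only [Finset.mul_sum, mul_left_comm (c j a), h]
  simp only [← mul_assoc, ← Finset.sum_mul, hlam, one_mul]

end LawrenceMap

/-! ### Kernel and Graver vectors of A in terms of its bouquets -/

section Bouquets

variable {m n d s : ℕ}

/-- The columns of `G` span the kernel, so a linear relation between two rows is a relation between
two coordinates of every kernel vector. -/
theorem IsGaleTransform.relation {A : Matrix (Fin m) (Fin n) ℤ}
    {G : Matrix (Fin n) (Fin d) ℤ} (h : IsGaleTransform A G) {x y : Fin n} {α β : ℚ}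
    (hG : ∀ l, α * (G x l : ℚ) = β * (G y l : ℚ)) {w : Fin n → ℤ} (hw : A.mulVec w = 0) :
    α * (w x : ℚ) = β * (w y : ℚ) := by
  have hw' : w ∈ Submodule.span ℤ (Set.range fun l : Fin d => G.transpose l) := by
    rw [h.2]
    simpa using hw
  induction hw' using Submodule.span_induction with
  | mem z hz => obtain ⟨l, rfl⟩ := hz; exact hG l
  | zero => simp
  | add z z' hz hz' ih ih' =>
    simp only [h.2, LinearMap.mem_ker, Matrix.mulVecLin_apply] at hz hz'
    push_cast [Pi.add_apply]
    linear_combination ih hz + ih' hz'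
  | smul q z hz ih =>
    simp only [h.2, LinearMap.mem_ker, Matrix.mulVecLin_apply] at hz
    push_cast [Pi.smul_apply, smul_eq_mul]
    linear_combination (q : ℚ) * ih hz

theorem IsMultiple.refl (x : Fin d → ℤ) : IsMultiple 1 x x := fun l => by simp

theorem IsMultiple.trans {p q : ℚ} {x y z : Fin d → ℤ} (h : IsMultiple p x y)
    (h' : IsMultiple q y z) : IsMultiple (p * q) x z := fun l => by
  rw [h l, h' l, mul_assoc]

theorem exists_isMultiple_of_reachable {G : Matrix (Fin n) (Fin d) ℤ} {x y : Fin n}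
    (h : (bouquetGraph G).Reachable x y) : ∃ q, IsMultiple q (G x) (G y) := by
  obtain ⟨p⟩ := h
  induction p with
  | nil => exact ⟨1, .refl _⟩
  | cons hadj _ ih =>
    obtain ⟨q, hq⟩ := hadj.2.1
    obtain ⟨q', hq'⟩ := ih
    exact ⟨q * q', hq.trans hq'⟩

namespace BouquetData

variable {A : Matrix (Fin m) (Fin n) ℤ} (B : BouquetData A s)

theorem D_apply (u : Fin s → ℤ) (j : Fin s) (a : Fin (B.r j + 1)) :
    B.D u (B.e ⟨j, a⟩) = B.c j a * u j :=
  lawrenceMap_apply B.e B.c u ⟨j, a⟩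

theorem D_add (u v : Fin s → ℤ) : B.D (u + v) = B.D u + B.D v :=
  map_add (lawrenceMap B.e B.c) u v

theorem mulVec_D (u : Fin s → ℤ) : A.mulVec (B.D u) = B.bouquetMatrix.mulVec u := by
  ext i
  simp only [Matrix.mulVec, dotProduct, bouquetMatrix, Matrix.of_apply]
  rw [← B.e.sum_comp, Fintype.sum_sigma]
  refine Finset.sum_congr rfl fun j _ => ?_
  rw [Finset.sum_mul]
  refine Finset.sum_congr rfl fun a _ => ?_
  rw [D_apply]
  ring

theorem exists_isMultiple (j : Fin s) (a b : Fin (B.r j + 1)) :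
    ∃ q, IsMultiple q (B.G (B.e ⟨j, a⟩)) (B.G (B.e ⟨j, b⟩)) :=
  exists_isMultiple_of_reachable ((B.reachable_iff _ _).2 rfl)

theorem c_ne_zero (j : Fin s) (a : Fin (B.r j + 1)) : B.c j a ≠ 0 := by
  by_cases hfree : B.IsFree j
  · exact (B.c_free j hfree).2 a
  · obtain ⟨l, hl, hc⟩ := B.c_nonfree j hfree
    rw [hc a]
    refine mul_ne_zero (by simpa using hl 0) fun h => hl a ?_
    have hd : (Finset.univ.gcd fun b => B.G (B.e ⟨j, b⟩) l) ∣ B.G (B.e ⟨j, a⟩) l :=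
      Finset.gcd_dvd (f := fun b => B.G (B.e ⟨j, b⟩) l) (Finset.mem_univ a)
    rw [← Int.ediv_mul_cancel hd, h, zero_mul]

/-- In a bouquet that is not free, `c` is primitive and proportional to a coordinate of `G`. -/
theorem exists_coordinate {j : Fin s} (hj : ¬ B.IsFree j) :
    ∃ l, (∀ a, B.G (B.e ⟨j, a⟩) l ≠ 0) ∧ 0 < B.c j 0 ∧ Finset.univ.gcd (B.c j) = 1 ∧
      ∃ g : ℤ, g ≠ 0 ∧ ∀ a, B.G (B.e ⟨j, a⟩) l = g * B.c j a := by
  obtain ⟨l, hl, hc⟩ := B.c_nonfree j hj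
  set f : Fin (B.r j + 1) → ℤ := fun a => B.G (B.e ⟨j, a⟩) l with hf
  have hd : ∀ a, Finset.univ.gcd f ∣ f a := fun a => Finset.gcd_dvd (Finset.mem_univ a)
  have hg0 : Finset.univ.gcd f ≠ 0 := fun h => hl 0 (Finset.gcd_eq_zero_iff.1 h 0 (by simp))
  have hgpos : 0 < Finset.univ.gcd f := by
    refine lt_of_le_of_ne ?_ hg0.symm
    rw [← Finset.normalize_gcd, ← Int.abs_eq_normalize]
    exact abs_nonneg _
  have hsign : (f 0).sign * (f 0).sign = 1 := by
    rcases lt_or_gt_of_ne (hl 0) with h | h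
    · simp [hf, Int.sign_eq_neg_one_of_neg h]
    · simp [hf, Int.sign_eq_one_of_pos h]
  have hca : ∀ a, f a = (f 0).sign * Finset.univ.gcd f * B.c j a := by
    intro a
    rw [hc a]
    have := Int.ediv_mul_cancel (hd a)
    change f a = (f 0).sign * Finset.univ.gcd f * ((f 0).sign * (f a / Finset.univ.gcd f))
    linear_combination (-1 : ℤ) * this - (f a / Finset.univ.gcd f) * Finset.univ.gcd f * hsign
  refine ⟨l, hl, ?_, ?_, _, ?_, hca⟩
  · have h := hca 0
    have h1 : (f 0).sign * f 0 = Finset.univ.gcd f * B.c j 0 := by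
      linear_combination (f 0).sign * h + Finset.univ.gcd f * B.c j 0 * hsign
    rw [Int.sign_mul_self_eq_abs] at h1
    have : 0 < |f 0| := abs_pos.2 (hl 0)
    rw [h1] at this
    exact (mul_pos_iff_of_pos_left hgpos).1 this
  · have h1 : B.c j = fun a => (f 0).sign * (f a / Finset.univ.gcd f) := funext hc
    rw [h1, Finset.gcd_mul_left, Finset.gcd_div_eq_one (Finset.mem_univ 0) (hl 0), mul_one,
      normalize_eq_one]
    exact IsUnit.of_mul_eq_one _ hsign
  · exact mul_ne_zero (fun h => by simp [h] at hsign) hg0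

theorem not_isFree {j : Fin s} (h : ∃ u, B.bouquetMatrix.mulVec u = 0 ∧ u j ≠ 0) :
    ¬ B.IsFree j := by
  rintro hj
  obtain ⟨u, hu, huj⟩ := h
  have h1 := B.isGale.relation (x := B.e ⟨j, 0⟩) (y := B.e ⟨j, 0⟩) (α := 1) (β := 0)
    (fun l => by simp [hj 0]) (w := B.D u) (by rw [mulVec_D, hu])
  rw [D_apply] at h1
  exact mul_ne_zero (B.c_ne_zero j 0) huj (by simpa using h1)

/-- Rows within a bouquet have the ratios of the entries of `c j`, so each block of a kernel vector
is proportional to `c j`; primitivity makes the factor an integer. -/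
theorem exists_eq_D (hfree : ∀ j, ¬ B.IsFree j) {w : Fin n → ℤ} (hw : A.mulVec w = 0) :
    ∃ u, B.bouquetMatrix.mulVec u = 0 ∧ B.D u = w := by
  have hpos : ∀ j, B.c j 0 ≠ 0 := fun j => B.c_ne_zero j 0
  have hlam : ∀ j, ∃ lam : Fin (B.r j + 1) → ℤ, ∑ a, lam a * B.c j a = 1 := by
    intro j
    obtain ⟨l, -, -, hgcd, -⟩ := B.exists_coordinate (hfree j)
    obtain ⟨f, hf⟩ := Finset.gcd_eq_sum_mul Finset.univ (B.c j)
    exact ⟨f, by rw [← hgcd, hf]; simp only [mul_comm]⟩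
  choose lam hlam using hlam
  obtain ⟨u, hu⟩ := exists_lawrenceMap_eq B.e B.c hlam hpos w fun j a => by
    obtain ⟨l, hl, -, -, g, hg, hgc⟩ := B.exists_coordinate (hfree j)
    obtain ⟨q, hq⟩ := B.exists_isMultiple j a 0
    have h1 := B.isGale.relation (x := B.e ⟨j, a⟩) (y := B.e ⟨j, 0⟩) (α := 1) (β := q)
      (fun l => by rw [one_mul, hq l]) hw
    have h2 := hq l
    rw [hgc, hgc] at h2
    push_cast at h2
    have h3 : (B.c j a : ℚ) = q * B.c j 0 := by
      apply mul_left_cancel₀ (Int.cast_ne_zero.2 hg : (g : ℚ) ≠ 0)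
      linear_combination h2
    have h4 : (B.c j 0 * w (B.e ⟨j, a⟩) : ℚ) = B.c j a * w (B.e ⟨j, 0⟩) := by
      linear_combination (B.c j 0 : ℚ) * h1 - (w (B.e ⟨j, 0⟩) : ℚ) * h3
    exact_mod_cast h4
  have hu' : B.D u = w := hu
  exact ⟨u, by rw [← mulVec_D, hu', hw], hu'⟩

/-- Ratios of rows are ratios of entries of `c j`, and the first entry is positive by normalization.
-/
theorem isNonMixed_iff {j : Fin s} (hj : ¬ B.IsFree j) : B.IsNonMixed j ↔ ∀ a, 0 < B.c j a := by
  obtain ⟨l, hl, hpos, -, g, hg, hgc⟩ := B.exists_coordinate hj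
  have hg' : (g : ℚ) ≠ 0 := Int.cast_ne_zero.2 hg
  have hratio : ∀ a b q, IsMultiple q (B.G (B.e ⟨j, a⟩)) (B.G (B.e ⟨j, b⟩)) →
      (B.c j a : ℚ) = q * B.c j b := by
    intro a b q hq
    have h2 := hq l
    rw [hgc, hgc] at h2
    push_cast at h2
    apply mul_left_cancel₀ hg'
    linear_combination h2
  constructor
  · rintro ⟨-, h⟩ a
    by_cases ha : a = 0
    · rwa [ha]
    obtain ⟨q, hq, hq'⟩ := h a 0 ⟨fun h => ha (by simpa using h),
      B.exists_isMultiple j a 0, B.exists_isMultiple j 0 a⟩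
    have := hratio _ _ _ hq'
    have h0 : (0 : ℚ) < B.c j 0 := by exact_mod_cast hpos
    have : (0 : ℚ) < B.c j a := by rw [this]; positivity
    exact_mod_cast this
  · intro h
    refine ⟨hj, fun a b hab => ?_⟩
    obtain ⟨q, hq⟩ := B.exists_isMultiple j a b
    refine ⟨q, ?_, hq⟩
    have h1 := hratio _ _ _ hq
    have ha : (0 : ℚ) < B.c j a := by exact_mod_cast h a
    have hb : (0 : ℚ) < B.c j b := by exact_mod_cast h b
    rw [h1] at ha
    exact (mul_pos_iff_of_pos_right hb).1 ha

/-- A decomposition of `B.D u` in Ker(A) lifts through `D` to Ker(T). Conformality can be read off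
at the first column of each bouquet, where `D` scales by a positive integer. -/
theorem D_mem_graver {t : ℕ} {T : Matrix (Fin t) (Fin s) ℤ} (hfree : ∀ j, ¬ B.IsFree j)
    (hT : ∀ u, B.bouquetMatrix.mulVec u = 0 ↔ T.mulVec u = 0) {u : Fin s → ℤ}
    (hu : u ∈ graver T) : B.D u ∈ graver A := by
  have hpos : ∀ j, 0 < B.c j 0 := fun j => (B.exists_coordinate (hfree j)).choose_spec.2.1
  have hinj : Function.Injective B.D := lawrenceMap_injective B.e B.c fun j => (hpos j).ne'
  have h0 : B.D 0 = 0 := map_zero (lawrenceMap B.e B.c)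
  refine ⟨by rw [mulVec_D, hT, hu.1], fun h => hu.2.1 (hinj (by rw [h, h0])), ?_⟩
  rintro ⟨v', w', hv', hw', hv0, hw0, huvw, hconf⟩
  obtain ⟨v, hv, rfl⟩ := B.exists_eq_D hfree hv'
  obtain ⟨w, hw, rfl⟩ := B.exists_eq_D hfree hw'
  rw [← D_add] at huvw
  refine hu.2.2 ⟨v, w, (hT v).1 hv, (hT w).1 hw, fun h => hv0 (by rw [h, h0]),
    fun h => hw0 (by rw [h, h0]), hinj huvw, fun j => ?_⟩
  have h1 := (hconf (B.e ⟨j, 0⟩)).1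
  have h2 := (hconf (B.e ⟨j, 0⟩)).2
  rw [D_apply, D_apply, ← mul_add] at h1 h2
  simp only [posPart_def, negPart_def] at h1 h2 ⊢
  have hc := hpos j
  have hmax : ∀ x, max (B.c j 0 * x) 0 = B.c j 0 * max x 0 := fun x => by
    rw [mul_max_of_nonneg _ _ hc.le, mul_zero]
  simp only [← mul_neg, hmax, ← mul_add] at h1 h2
  exact ⟨mul_left_cancel₀ hc.ne' h1, mul_left_cancel₀ hc.ne' h2⟩

end BouquetData

end Bouquets


/-! ### Generalized Lawrence matrices and the Lawrence lifting -/

section Lawrence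

variable {s t : ℕ}

theorem lawrenceC_mulVec_eq_zero_iff {r : ℕ} (c w : Fin (r + 1) → ℤ) :
    (lawrenceC c).mulVec w = 0 ↔ ∀ a, c 0 * w a = c a * w 0 := by
  have h : ∀ i : Fin r, (lawrenceC c).mulVec w i = c 0 * w i.succ - c i.succ * w 0 := by
    intro i
    simp only [Matrix.mulVec, dotProduct, lawrenceC, Matrix.of_apply, Fin.sum_univ_succ,
      if_true, Fin.succ_ne_zero, if_false, Fin.succ_inj, ite_mul, zero_mul,
      Finset.sum_ite_eq', Finset.mem_univ]
    ring
  rw [funext_iff, Fin.forall_fin_succ (P := fun a => c 0 * w a = c a * w 0)]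
  simp [h, sub_eq_zero]

/-- The blocks C_j make each block of `w` proportional to `c j`, so `w` comes from some `u`; by the
Bézout relation the top row then evaluates to `T` at `u`. -/
theorem generalizedLawrence_mulVec_eq_zero_iff {n : ℕ} {r : Fin s → ℕ}
    (T : Matrix (Fin 1) (Fin s) ℤ) {c lam : ∀ j : Fin s, Fin (r j + 1) → ℤ}
    (hlam : ∀ j, ∑ a, lam j a * c j a = 1) (hc : ∀ j, c j 0 ≠ 0)
    (e : (Σ j : Fin s, Fin (r j + 1)) ≃ Fin n) (w : Fin n → ℤ) :
    ((generalizedLawrence T c lam).submatrix id e.symm).mulVec w = 0 ↔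
      ∃ u, T.mulVec u = 0 ∧ lawrenceMap e c u = w := by
  have h1 : ((generalizedLawrence T c lam).submatrix id e.symm).mulVec w =
      (generalizedLawrence T c lam).mulVec (w ∘ e) := by
    rw [Matrix.submatrix_mulVec_equiv]
    rfl
  have h2 : (generalizedLawrence T c lam).mulVec (w ∘ e) = 0 ↔
      (∑ j, (∑ a, lam j a * w (e ⟨j, a⟩)) * T 0 j = 0) ∧
      ∀ j, (lawrenceC (c j)).mulVec (fun a => w (e ⟨j, a⟩)) = 0 := by
    rw [generalizedLawrence, Matrix.fromRows_mulVec]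
    constructor
    · intro h
      refine ⟨?_, fun j => ?_⟩
      · have := congrFun h (Sum.inl 0)
        simp only [Sum.elim_inl, Matrix.mulVec, dotProduct, Matrix.of_apply,
          Fintype.sum_sigma, Function.comp_apply, Pi.zero_apply] at this
        rw [← this]
        refine Finset.sum_congr rfl fun j _ => ?_
        rw [Finset.sum_mul]
        exact Finset.sum_congr rfl fun a _ => by ring
      · ext b
        have := congrFun h (Sum.inr ⟨j, b⟩)
        simp only [Sum.elim_inr, Pi.zero_apply] at this
        rw [Pi.zero_apply, ← this]
        simp only [Matrix.mulVec, dotProduct, Fintype.sum_sigma, Matrix.blockDiagonal'_apply]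
        rw [Finset.sum_eq_single j]
        · simp
        · intro k _ hk
          simp [hk.symm]
        · simp
    · rintro ⟨h, h'⟩
      ext (i | ⟨j, b⟩)
      · simp only [Sum.elim_inl, Matrix.mulVec, dotProduct, Matrix.of_apply,
          Fintype.sum_sigma, Function.comp_apply, Pi.zero_apply]
        rw [← h]
        refine Finset.sum_congr rfl fun j _ => ?_
        rw [Finset.sum_mul, Subsingleton.elim i 0]
        exact Finset.sum_congr rfl fun a _ => by ring
      · have := congrFun (h' j) b
        simp only [Sum.elim_inr, Pi.zero_apply] at this ⊢
        rw [← this]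
        simp only [Matrix.mulVec, dotProduct, Fintype.sum_sigma, Matrix.blockDiagonal'_apply]
        rw [Finset.sum_eq_single j]
        · simp
        · intro k _ hk
          simp [hk.symm]
        · simp
  rw [h1, h2]
  simp only [lawrenceC_mulVec_eq_zero_iff]
  have hsum : ∀ u, ∑ j, (∑ a, lam j a * lawrenceMap e c u (e ⟨j, a⟩)) * T 0 j =
      T.mulVec u 0 := by
    intro u
    refine Finset.sum_congr rfl fun j _ => ?_
    simp only [lawrenceMap_apply, ← mul_assoc, ← Finset.sum_mul, hlam]
    ring
  constructor
  · rintro ⟨h, h'⟩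
    obtain ⟨u, rfl⟩ := exists_lawrenceMap_eq e c hlam hc w h'
    rw [hsum] at h
    exact ⟨u, funext fun i => by rw [Subsingleton.elim i 0, h]; rfl, rfl⟩
  · rintro ⟨u, hu, rfl⟩
    refine ⟨by rw [hsum, hu]; rfl, fun j a => ?_⟩
    simp only [lawrenceMap_apply]
    ring

/-- A matrix whose kernel is the image under `u ↦ (u, -u)` of `Ker_ℤ(T)`, where no two coordinates
are proportional on `Ker_ℤ(T)`, has singleton bouquets of `T` doubled to mixed bouquets. -/
theorem exists_bouquetData_lawrence {m n : ℕ} (T : Matrix (Fin t) (Fin s) ℤ)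
    (hT : ∀ i j, i ≠ j → ∃ u, T.mulVec u = 0 ∧ u i = 0 ∧ u j ≠ 0)
    (hT' : ∀ j, ∃ u, T.mulVec u = 0 ∧ u j ≠ 0)
    (e : (Σ _ : Fin s, Fin (1 + 1)) ≃ Fin n) (c : ∀ _ : Fin s, Fin (1 + 1) → ℤ)
    (hc : c = fun _ => ![1, -1]) (A : Matrix (Fin m) (Fin n) ℤ)
    (hA : ∀ w, A.mulVec w = 0 ↔ ∃ u, T.mulVec u = 0 ∧ lawrenceMap (r := fun _ => 1) e c u = w) :
    ∃ B : BouquetData A s, B.D = lawrenceMap (r := fun _ => 1) e c ∧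
      ∀ j, ∃ a, B.c j a < 0 := by
  obtain ⟨d, b⟩ := Submodule.basisOfPid (Pi.basisFun ℤ (Fin s)) (LinearMap.ker T.mulVecLin)
  set M := lawrenceMap (r := fun _ => 1) e c with hM
  have hMinj : Function.Injective M := lawrenceMap_injective e c fun j => by simp [hc]
  -- The columns are the images of a basis of Ker(T), hence a basis of Ker(A).
  let G : Matrix (Fin n) (Fin d) ℤ := Matrix.of fun i l => M (b l) i
  have hG : ∀ p l, G (e p) l = c p.1 p.2 * (b l : Fin s → ℤ) p.1 := fun p l =>
    lawrenceMap_apply (r := fun _ => 1) e c _ p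
  have hGale : IsGaleTransform A G := by
    have hcol : (fun l : Fin d => G.transpose l) =
        (M ∘ₗ (LinearMap.ker T.mulVecLin).subtype) ∘ b := rfl
    refine ⟨?_, ?_⟩
    · rw [hcol]
      refine b.linearIndependent.map' _ (LinearMap.ker_eq_bot.2 ?_)
      exact hMinj.comp Subtype.val_injective
    · rw [hcol, Set.range_comp, Submodule.span_image, b.span_eq, Submodule.map_top,
        LinearMap.range_comp, Submodule.range_subtype]
      ext w
      simp [hA, Submodule.mem_map]
  have hker : ∀ {α β : ℚ} {p q}, (∀ l, α * (G (e p) l : ℚ) = β * (G (e q) l : ℚ)) →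
      ∀ u, T.mulVec u = 0 → α * (c p.1 p.2 * u p.1 : ℚ) = β * (c q.1 q.2 * u q.1 : ℚ) := by
    intro α β p q h u hu
    have := hGale.relation h ((hA (M u)).2 ⟨u, hu, rfl⟩)
    rw [hM, lawrenceMap_apply, lawrenceMap_apply] at this
    exact_mod_cast this
  have hc0 : ∀ p : Σ _ : Fin s, Fin (1 + 1), c p.1 p.2 * c p.1 p.2 = 1 := by
    rintro ⟨j, a⟩
    fin_cases a <;> simp [hc]
  have hnz : ∀ p : Σ _ : Fin s, Fin (1 + 1), ∃ l, G (e p) l ≠ 0 := by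
    intro p
    by_contra! hcon
    obtain ⟨u, hu, hup⟩ := hT' p.1
    have h1 := hker (α := 1) (β := 0) (p := p) (q := p) (fun l => by simp [hcon l]) u hu
    have h2 : c p.1 p.2 * u p.1 = 0 := by
      have : ((c p.1 p.2 * u p.1 : ℤ) : ℚ) = 0 := by push_cast; linarith
      exact_mod_cast this
    have h3 := hc0 p
    rcases mul_eq_zero.1 h2 with h | h
    · simp [h] at h3
    · exact hup h
  have hmult : ∀ j a a', ∃ q, IsMultiple q (G (e ⟨j, a⟩)) (G (e ⟨j, a'⟩)) := by
    intro j a a'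
    -- The entries of `c` are ±1, so this product is their quotient.
    refine ⟨c j a * c j a', fun l => ?_⟩
    rw [hG, hG]
    have : (c j a' * c j a' : ℚ) = 1 := by exact_mod_cast hc0 ⟨j, a'⟩
    push_cast
    linear_combination (-1 : ℚ) * (c j a * (b l : Fin s → ℤ) j) * this
  have hreach : ∀ p q, (bouquetGraph G).Reachable (e p) (e q) ↔ p.1 = q.1 := by
    rintro p q
    constructor
    · intro h
      by_contra hne
      obtain ⟨x, hx⟩ := exists_isMultiple_of_reachable h.symm
      -- A kernel vector vanishing at the block of `p` but not at that of `q` rules out row `q`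
      -- being a multiple of row `p`.
      obtain ⟨u, hu, hu0, hu1⟩ := hT p.1 q.1 hne
      have h1 := hker (α := 1) (β := x) (p := q) (q := p) (fun l => by rw [one_mul, hx l]) u hu
      have h2 : c q.1 q.2 * u q.1 = 0 := by
        have : ((c q.1 q.2 * u q.1 : ℤ) : ℚ) = 0 := by
          push_cast
          rw [hu0] at h1
          simpa using h1
        exact_mod_cast this
      have h3 := hc0 q
      rcases mul_eq_zero.1 h2 with h | h
      · simp [h] at h3
      · exact hu1 h
    · obtain ⟨j, a⟩ := p
      obtain ⟨k, a'⟩ := q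
      rintro (rfl : j = k)
      by_cases ha : a = a'
      · rw [ha]
      · exact SimpleGraph.Adj.reachable
          ⟨fun h => ha (by simpa using h), hmult j a a', hmult j a' a⟩
  refine ⟨⟨d, G, hGale, fun _ => 1, e, hreach, c, ?_, ?_⟩, rfl, fun j => ⟨1, by simp [hc]⟩⟩
  · intro j hj
    obtain ⟨l, hl⟩ := hnz ⟨j, 0⟩
    exact absurd (congrFun (hj 0) l) hl
  · intro j _
    obtain ⟨l, hl⟩ := hnz ⟨j, 0⟩
    set x : ℤ := (b l : Fin s → ℤ) j with hx
    have hGx : ∀ a, G (e ⟨j, a⟩) l = c j a * x := fun a => hG ⟨j, a⟩ l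
    have hx0 : x ≠ 0 := by
      rintro h
      rw [hGx, h, mul_zero] at hl
      exact hl rfl
    have hgcd : (Finset.univ.gcd fun a => G (e ⟨j, a⟩) l) = |x| := by
      have : (fun a => G (e ⟨j, a⟩) l) = fun a => x * c j a := by
        ext a
        rw [hGx, mul_comm]
      rw [this, Finset.gcd_mul_left, ← Int.abs_eq_normalize]
      have h1 : Finset.univ.gcd (c j) ∣ c j 0 := Finset.gcd_dvd (by simp)
      have h2 : Finset.univ.gcd (c j) = 1 := by
        rw [← Finset.normalize_gcd, normalize_eq_one]
        exact isUnit_of_dvd_one (by simpa [hc] using h1)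
      rw [h2, mul_one]
    have hsx : x.sign * x = |x| := Int.sign_mul_self_eq_abs x
    refine ⟨l, fun a h => ?_, fun a => ?_⟩
    · rw [hGx] at h
      have h3 := hc0 ⟨j, a⟩
      rcases mul_eq_zero.1 h with h | h
      · simp [h] at h3
      · exact hx0 h
    · have h0 : c j 0 = 1 := by simp [hc]
      rw [hgcd, hGx, hGx, h0, one_mul, ← hsx]
      have hss : x.sign * x.sign = 1 := by
        rcases lt_or_gt_of_ne hx0 with h | h
        · simp [Int.sign_eq_neg_one_of_neg h]
        · simp [Int.sign_eq_one_of_pos h]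
      have : c j a * x = (x.sign * x) * (x.sign * c j a) := by
        linear_combination (-1 : ℤ) * c j a * x * hss
      rw [this, Int.mul_ediv_cancel_left _ (by rw [hsx]; exact abs_ne_zero.2 hx0)]
      linear_combination (-1 : ℤ) * c j a * hss

end Lawrence


/-! ### Monomial curves: circuits and faces of the strongly robust complex -/

section MonomialCurve

variable {s : ℕ}

/-- The kernel of a row with pointed kernel is that of a row of positive integers. -/
theorem PointedKernel.exists_pos (hs : 2 ≤ s) {T : Matrix (Fin 1) (Fin s) ℤ}
    (hT : PointedKernel T) :
    ∃ N : Fin s → ℕ, (∀ j, 0 < N j) ∧ ∀ u, T.mulVec u = 0 ↔ ∑ j, (N j : ℤ) * u j = 0 := by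
  have hmul : ∀ u, T.mulVec u = 0 ↔ ∑ j, T 0 j * u j = 0 := by
    intro u
    rw [funext_iff, Fin.forall_fin_one]
    rfl
  have h0 : ∀ j, T 0 j ≠ 0 := by
    intro j hj
    have h := hT (Pi.single j 1) ((hmul _).2 (by simp [Pi.single_apply, hj])) fun i => by
      simp only [Pi.single_apply]
      split_ifs <;> simp
    simpa using congrFun h j
  have hsign : ∀ i j, 0 < T 0 i → ¬ T 0 j < 0 := by
    intro i j hi hj
    have hij : i ≠ j := by rintro rfl; omega
    -- Entries of opposite sign would produce this nonzero nonnegative kernel vector.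
    have h := hT (Pi.single i (-T 0 j) + Pi.single j (T 0 i)) ((hmul _).2 ?_) fun k => ?_
    · have := congrFun h i
      simp [hij] at this
      omega
    · simp only [Pi.add_apply, mul_add, Finset.sum_add_distrib, Pi.single_apply, mul_ite,
        mul_zero, Finset.sum_ite_eq', Finset.mem_univ, if_true]
      ring
    · simp only [Pi.add_apply, Pi.single_apply]
      split_ifs <;> omega
  refine ⟨fun j => (T 0 j).natAbs, fun j => Int.natAbs_pos.2 (h0 j), fun u => ?_⟩
  rw [hmul]
  rcases lt_or_gt_of_ne (h0 ⟨0, by omega⟩) with h | h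
  · have : ∀ j, ((T 0 j).natAbs : ℤ) = -T 0 j := by
      intro j
      have h1 := h0 j
      have h2 := hsign j _ |>.mt (not_not.2 h)
      omega
    simp [this]
  · have : ∀ j, ((T 0 j).natAbs : ℤ) = T 0 j := by
      intro j
      have h1 := hsign _ j h
      omega
    simp only [this]

variable {t : ℕ} {T : Matrix (Fin t) (Fin s) ℤ} {N : Fin s → ℕ}

theorem sum_mul_single_add_single (N : Fin s → ℕ) (i j : Fin s) (x y : ℤ) :
    ∑ l, (N l : ℤ) * (Pi.single i x + Pi.single j y : Fin s → ℤ) l = N i * x + N j * y := by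
  simp [Pi.single_apply, mul_add, Finset.sum_add_distrib]

/-- A conformal summand z is supported on {j, k} with p z_j = -q z_k, so coprimality gives q ∣ z_j.
Two nonzero summands would contribute at least 2q to a coordinate equal to q. -/
theorem circuit_mem_graver (hN : ∀ j, 0 < N j)
    (hT : ∀ u, T.mulVec u = 0 ↔ ∑ j, (N j : ℤ) * u j = 0) {j k : Fin s} (hjk : j ≠ k)
    {g p q : ℕ} (hpq : p.Coprime q) (hj : N j = p * g) (hk : N k = q * g) :
    (Pi.single j (q : ℤ) + Pi.single k (-(p : ℤ)) : Fin s → ℤ) ∈ graver T := by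
  have hp : 0 < p := Nat.pos_of_ne_zero fun h => by have := hN j; simp [hj, h] at this
  have hq : 0 < q := Nat.pos_of_ne_zero fun h => by have := hN k; simp [hk, h] at this
  have hg : 0 < g := Nat.pos_of_ne_zero fun h => by have := hN k; simp [hk, h] at this
  refine ⟨?_, fun h => ?_, ?_⟩
  · rw [hT, sum_mul_single_add_single, hj, hk]
    push_cast
    ring
  · have := congrFun h j
    simp [hjk] at this
    omega
  rintro ⟨v, w, hv, hw, hv0, hw0, huvw, hconf⟩
  have hu : ∀ l, v l + w l = (Pi.single j (q : ℤ) + Pi.single k (-(p : ℤ)) : Fin s → ℤ) l :=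
    fun l => (congrFun huvw l).symm
  have hoff : ∀ l, l ≠ j → l ≠ k → v l = 0 ∧ w l = 0 := by
    intro l hlj hlk
    have h1 := hu l
    have h2 := hconf l
    simp only [Pi.add_apply, Pi.single_apply, hlj, hlk, if_false] at h1
    simp only [posPart_def, negPart_def] at h2
    omega
  have hshape : ∀ z : Fin s → ℤ, (∀ l, l ≠ j → l ≠ k → z l = 0) → T.mulVec z = 0 →
      z ≠ 0 → 0 ≤ z j → (q : ℤ) ≤ z j := by
    intro z hz hTz hz0 hzj
    have hz' : z = Pi.single j (z j) + Pi.single k (z k) := by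
      ext l
      simp only [Pi.add_apply, Pi.single_apply]
      by_cases h1 : l = j
      · subst h1
        simp [hjk]
      · by_cases h2 : l = k
        · subst h2
          simp [h1]
        · simp [h1, h2, hz l h1 h2]
    rw [hT, hz', sum_mul_single_add_single, hj, hk] at hTz
    have h1 : (p : ℤ) * z j = q * (-z k) := by
      have hg' : (g : ℤ) ≠ 0 := by positivity
      apply mul_left_cancel₀ hg'
      push_cast at hTz
      linear_combination hTz
    have hdvd : (q : ℤ) ∣ z j := by
      refine IsCoprime.dvd_of_dvd_mul_left (Nat.isCoprime_iff_coprime.2 hpq.symm)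
        (Dvd.intro _ h1.symm)
    refine Int.le_of_dvd (lt_of_le_of_ne hzj fun h => hz0 ?_) hdvd
    have hzk : z k = 0 := by
      rw [← h, mul_zero] at h1
      have hq' : (q : ℤ) ≠ 0 := by positivity
      have := (mul_eq_zero.1 h1.symm).resolve_left hq'
      omega
    rw [hz', ← h, hzk]
    simp
  have h1 := hu j
  have h2 := hconf j
  simp only [Pi.add_apply, Pi.single_apply, hjk, if_true, if_false] at h1
  simp only [posPart_def, negPart_def] at h2
  have h3 := hshape v (fun l h h' => (hoff l h h').1) hv hv0 (by omega)
  have h4 := hshape w (fun l h h' => (hoff l h h').2) hw hw0 (by omega)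
  omega

/-- If `i` lies in a face of the strongly robust complex, then the circuit on `{j, k}` does not
split off the circuit on `{i, j}`. -/
theorem lcm_lt_of_isNonMixed {m n : ℕ} {A : Matrix (Fin m) (Fin n) ℤ} (B : BouquetData A s)
    (hN : ∀ j, 0 < N j) (hT : ∀ u, T.mulVec u = 0 ↔ ∑ j, (N j : ℤ) * u j = 0)
    (hB : ∀ u, B.bouquetMatrix.mulVec u = 0 ↔ T.mulVec u = 0)
    (h : tIndispensable T A B = graver T) {i j k : Fin s} (hi : B.IsNonMixed i)
    (hij : i ≠ j) (hik : i ≠ k) (hjk : j ≠ k) :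
    (N j).lcm (N k) < (N i).lcm (N j) := by
  obtain ⟨p, q, hpq, hp, hq⟩ := Nat.exists_coprime (N j) (N k)
  obtain ⟨x, y, hxy, hx, hy⟩ := Nat.exists_coprime (N i) (N j)
  have hypos : 0 < y := Nat.pos_of_ne_zero fun h => by
    rw [h, zero_mul] at hy
    exact (hN j).ne' hy
  have hc : ∀ a, 0 < B.c i a := (B.isNonMixed_iff hi.1).1 hi
  by_contra! hle
  have hgj : 0 < (N j).gcd (N k) := Nat.gcd_pos_of_pos_left _ (hN j)
  have hgi : 0 < (N i).gcd (N j) := Nat.gcd_pos_of_pos_left _ (hN i)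
  have e1 : (N j).lcm (N k) = N j * q := by
    rw [Nat.lcm, Nat.div_eq_of_eq_mul_left hgj]
    rw [mul_assoc, ← hq]
  have e2 : (N i).lcm (N j) = N j * x := by
    rw [Nat.lcm, Nat.div_eq_of_eq_mul_left hgi]
    rw [mul_assoc, ← hx, mul_comm]
  -- Both lcms are multiples of N_j, with cofactors q and x, so the negated inequality is x ≤ q.
  have hxq : x ≤ q := by
    rw [e1, e2] at hle
    exact Nat.le_of_mul_le_mul_left hle (hN j)
  have hmem := circuit_mem_graver hN hT hjk hpq hp hq
  rw [← h] at hmem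
  -- The splitting is u = v + (u - v) with v = -y e_i + x e_j and u - v = y e_i + (q - x) e_j - p
  -- e_k. At j the summands do not have opposite signs because x ≤ q, and at k the first one
  -- vanishes. At i they have opposite signs, which semiconformality allows in this order because
  -- all entries of `B.c i` are positive.
  set v : Fin s → ℤ := Pi.single i (-(y : ℤ)) + Pi.single j (x : ℤ) with hv
  set u : Fin s → ℤ := Pi.single j (q : ℤ) + Pi.single k (-(p : ℤ)) with hu
  have hTv : T.mulVec v = 0 := by
    have h1 : (N j : ℤ) = y * (N i).gcd (N j) := by exact_mod_cast hy
    have h2 : (N i : ℤ) = x * (N i).gcd (N j) := by exact_mod_cast hx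
    rw [hT, hv, sum_mul_single_add_single]
    linear_combination (-y : ℤ) * h2 + x * h1
  have hTu : T.mulVec u = 0 := hmem.1.1
  have hTw : T.mulVec (u - v) = 0 := by rw [Matrix.mulVec_sub, hTu, hTv, sub_zero]
  have hvi : v i = -y := by simp [hv, hij]
  have hwi : (u - v) i = y := by simp [hu, hvi, hij, hik]
  have hnz : ∀ z : Fin s → ℤ, z i ≠ 0 → B.D z ≠ 0 := by
    intro z hz hD
    have := congrFun hD (B.e ⟨i, 0⟩)
    rw [B.D_apply] at this
    exact mul_ne_zero (hc 0).ne' hz this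
  refine hmem.2.2.2 ⟨B.D v, B.D (u - v), ?_, ?_, hnz v (by omega), hnz _ (by omega), ?_, ?_⟩
  · rw [B.mulVec_D, hB, hTv]
  · rw [B.mulVec_D, hB, hTw]
  · rw [← B.D_add, add_sub_cancel]
  intro l
  obtain ⟨⟨l, a⟩, rfl⟩ := B.e.surjective l
  rw [B.D_apply, B.D_apply]
  by_cases hli : l = i
  · subst hli
    rw [hvi, hwi]
    have hca := hc a
    have : 0 < B.c l a * y := by positivity
    constructor <;> intro <;> linarith
  · have hcases : (0 ≤ v l ∧ 0 ≤ (u - v) l) ∨ (v l = 0) := by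
      by_cases hlj : l = j
      · subst hlj
        left
        simp only [hv, hu, Pi.sub_apply, Pi.add_apply, Pi.single_apply, hli, hjk, if_true,
          if_false]
        omega
      · right
        simp [hv, hli, hlj]
    rcases hcases with ⟨h1, h2⟩ | h1
    · constructor
      · intro h3
        exact mul_nonneg (pos_of_mul_pos_left h3 h1).le h2
      · intro h3
        exact mul_nonpos_of_nonpos_of_nonneg (neg_of_mul_neg_left h3 h2).le h1
    · simp [h1]

theorem exists_ne_ne (hs : 3 ≤ s) (i j : Fin s) : ∃ k, k ≠ i ∧ k ≠ j := by
  obtain ⟨k, hk⟩ := Finset.exists_mem_notMem_of_card_lt_card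
    (s := {i, j}) (t := (Finset.univ : Finset (Fin s)))
    (lt_of_le_of_lt Finset.card_le_two (by simp; omega))
  exact ⟨k, by simpa using hk⟩

/-- With a third index k, the vector N_k e_j - N_j e_k avoids i. This makes the bouquets of `T`
singletons and non-free. -/
theorem exists_kernel_eq_zero_ne_zero (hs : 3 ≤ s) (hN : ∀ j, 0 < N j)
    (hT : ∀ u, T.mulVec u = 0 ↔ ∑ j, (N j : ℤ) * u j = 0) {i j : Fin s} (hij : i ≠ j) :
    ∃ u, T.mulVec u = 0 ∧ u i = 0 ∧ u j ≠ 0 := by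
  obtain ⟨k, hki, hkj⟩ := exists_ne_ne hs i j
  refine ⟨Pi.single j (N k : ℤ) + Pi.single k (-(N j : ℤ)), ?_, ?_, ?_⟩
  · rw [hT, sum_mul_single_add_single]
    ring
  · simp [hij, hki.symm]
  · simp [hkj.symm, (hN k).ne']

/-- The lcm inequality involves only N, so it can be compared between different robust ideals
realizing the two faces; a third index k gives contradictory inequalities. -/
theorem eq_of_mem_stronglyRobustComplex {K : Type*} [Field K] (hs : 3 ≤ s) (hN : ∀ j, 0 < N j)
    (hT : ∀ u, T.mulVec u = 0 ↔ ∑ j, (N j : ℤ) * u j = 0) {ω ω' : Set (Fin s)}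
    (hω : ω ∈ stronglyRobustComplex K T) (hω' : ω' ∈ stronglyRobustComplex K T)
    {i j : Fin s} (hi : i ∈ ω) (hj : j ∈ ω') : i = j := by
  by_contra hij
  obtain ⟨k, hki, hkj⟩ := exists_ne_ne hs i j
  obtain ⟨_, _, A, B, ⟨-, hB, rfl⟩, h⟩ := hω
  obtain ⟨_, _, A', B', ⟨-, hB', rfl⟩, h'⟩ := hω'
  have h1 := lcm_lt_of_isNonMixed B hN hT (mulVec_eq_zero_iff_of_toricIdeal_eq hB) h hi
    hki.symm hij hkj
  have h2 := lcm_lt_of_isNonMixed B' hN hT (mulVec_eq_zero_iff_of_toricIdeal_eq hB') h' hj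
    hkj.symm (Ne.symm hij) hki
  rw [Nat.lcm_comm (N k)] at h1 h2
  exact lt_asymm h1 h2

end MonomialCurve

/-- The Lawrence lifting, whose kernel is {(u, -u)}, realizes the empty face: every bouquet is
mixed, and imposing semiconformality on both copies of a coordinate excludes opposite signs in
either order, leaving conformality. -/
theorem empty_mem_stronglyRobustComplex {K : Type*} [Field K] {s : ℕ} (hs : 3 ≤ s)
    {T : Matrix (Fin 1) (Fin s) ℤ} (hTp : PointedKernel T) :
    ∅ ∈ stronglyRobustComplex K T := by
  obtain ⟨N, hN, hT⟩ := hTp.exists_pos (by omega)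
  let c : ∀ _ : Fin s, Fin (1 + 1) → ℤ := fun _ => ![1, -1]
  let lam : ∀ _ : Fin s, Fin (1 + 1) → ℤ := fun _ => ![1, 0]
  let e := Fintype.equivFin (Σ _ : Fin s, Fin (1 + 1))
  let f := Fintype.equivFin (Fin 1 ⊕ Σ _ : Fin s, Fin 1)
  let A := (generalizedLawrence (r := fun _ => 1) T c lam).submatrix f.symm e.symm
  have hA : ∀ w, A.mulVec w = 0 ↔
      ∃ u, T.mulVec u = 0 ∧ lawrenceMap (r := fun _ => 1) e c u = w := by
    intro w
    rw [← generalizedLawrence_mulVec_eq_zero_iff (r := fun _ => 1) T (lam := lam)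
      (by simp [c, lam]) (by simp [c])]
    have : A.mulVec w = ((generalizedLawrence (r := fun _ => 1) T c lam).submatrix
        id e.symm).mulVec w ∘ f.symm := rfl
    rw [this]
    constructor
    · intro h
      ext x
      simpa using congrFun h (f x)
    · intro h
      rw [h]
      rfl
  obtain ⟨B, hD, hneg⟩ := exists_bouquetData_lawrence T
    (fun i j hij => exists_kernel_eq_zero_ne_zero hs hN hT hij)
    (fun j => by
      obtain ⟨k, hk, -⟩ := exists_ne_ne hs j j
      obtain ⟨u, hu, -, huj⟩ := exists_kernel_eq_zero_ne_zero hs hN hT hk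
      exact ⟨u, hu, huj⟩) e c rfl A hA
  have hinj : Function.Injective B.D := by
    rw [hD]
    exact lawrenceMap_injective (r := fun _ => 1) e c fun j => by simp [c]
  have hDapply : ∀ u p, B.D u (e p) = c p.1 p.2 * u p.1 := by
    intro u p
    rw [hD, lawrenceMap_apply]
  have hD0 : B.D 0 = 0 := by rw [hD, map_zero]
  have hker : ∀ u, B.bouquetMatrix.mulVec u = 0 ↔ T.mulVec u = 0 := by
    intro u
    rw [← B.mulVec_D, hA, ← hD]
    exact ⟨fun ⟨v, hv, hvu⟩ => hinj hvu ▸ hv, fun h => ⟨u, h, rfl⟩⟩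
  refine ⟨_, _, A, B, ⟨?_, toricIdeal_congr hker, ?_⟩, ?_⟩
  · intro w hw hw0
    obtain ⟨u, hu, rfl⟩ := (hA w).1 hw
    rw [← hD] at hw0 ⊢
    have : u = 0 := by
      ext j
      have h1 := hw0 (e ⟨j, 0⟩)
      have h2 := hw0 (e ⟨j, 1⟩)
      rw [hDapply] at h1 h2
      simp only [c, Matrix.cons_val_zero, Matrix.cons_val_one] at h1 h2
      simp only [Pi.zero_apply]
      omega
    rw [this, hD0]
  · symm
    rw [Set.eq_empty_iff_forall_notMem]
    intro j hj
    obtain ⟨a, ha⟩ := hneg j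
    exact lt_asymm ha ((B.isNonMixed_iff hj.1).1 hj a)
  · refine Set.Subset.antisymm (fun u hu => hu.1) fun u hu => ⟨hu, ?_⟩
    refine ⟨by rw [B.mulVec_D, hker, hu.1], fun h => hu.2.1 (hinj (by rw [h, hD0])), ?_⟩
    rintro ⟨v', w', hv', hw', hv0, hw0, huvw, hsemi⟩
    obtain ⟨v, hv, rfl⟩ := (hA v').1 hv'
    obtain ⟨w, hw, rfl⟩ := (hA w').1 hw'
    rw [← hD] at huvw hsemi hv0 hw0
    rw [← B.D_add] at huvw
    refine hu.2.2 ⟨v, w, hv, hw, fun h => hv0 (by rw [h, hD0]),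
      fun h => hw0 (by rw [h, hD0]), hinj huvw, fun j => ?_⟩
    have h1 := hsemi (e ⟨j, 0⟩)
    have h2 := hsemi (e ⟨j, 1⟩)
    rw [hDapply, hDapply] at h1 h2
    simp only [c, Matrix.cons_val_zero, Matrix.cons_val_one] at h1 h2
    simp only [posPart_def, negPart_def]
    omega

end ToricBouquet

theorem mainTheorem7 {K : Type*} [Field K] {m n s : ℕ}
    (A : Matrix (Fin m) (Fin n) ℤ) (hA : ToricBouquet.PointedKernel A)
    (hrobust : ToricBouquet.IsStronglyRobust K A)
    (hs : 3 ≤ s) (T : Matrix (Fin 1) (Fin s) ℤ) (hT : ToricBouquet.PointedKernel T)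
    (hAT : ToricBouquet.HasBouquetIdeal K A T) :
    ∃ (r : Fin s → ℕ) (c lam : ∀ j : Fin s, Fin (r j + 1) → ℤ)
      (σ : (Σ j : Fin s, Fin (r j + 1)) ≃ Fin n),
      (∀ j a, c j a ≠ 0) ∧
      (∀ j, Finset.univ.gcd (c j) = 1) ∧
      (∀ j, ∑ a, lam j a * c j a = 1) ∧
      ToricBouquet.toricIdeal K A =
        ToricBouquet.toricIdeal K
          ((ToricBouquet.generalizedLawrence T c lam).submatrix id σ.symm) ∧
      (∀ j, 0 < c j 0) ∧
      ((ToricBouquet.stronglyRobustComplex K T = {∅} ∧ ∀ j, ∃ a, c j a < 0) ∨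
        ∃ i : Fin s, ToricBouquet.stronglyRobustComplex K T = {∅, {i}} ∧
          ∀ j, j ≠ i → ∃ a, c j a < 0) := by
  open ToricBouquet in
  obtain ⟨B, hB⟩ := hAT
  obtain ⟨N, hN, hTN⟩ := hT.exists_pos (by omega)
  have hker := mulVec_eq_zero_iff_of_toricIdeal_eq hB
  have hfree : ∀ j, ¬ B.IsFree j := by
    intro j
    obtain ⟨k, hk, -⟩ := exists_ne_ne hs j j
    obtain ⟨u, hu, -, huj⟩ := exists_kernel_eq_zero_ne_zero hs hN hTN hk
    exact B.not_isFree ⟨u, (hker u).2 hu, huj⟩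
  have hpos : ∀ j, 0 < B.c j 0 := fun j => (B.exists_coordinate (hfree j)).choose_spec.2.1
  have hgcd : ∀ j, Finset.univ.gcd (B.c j) = 1 :=
    fun j => (B.exists_coordinate (hfree j)).choose_spec.2.2.1
  have hlam : ∀ j, ∃ lam : Fin (B.r j + 1) → ℤ, ∑ a, lam a * B.c j a = 1 := by
    intro j
    obtain ⟨f, hf⟩ := Finset.gcd_eq_sum_mul Finset.univ (B.c j)
    exact ⟨f, by rw [← hgcd j, hf]; simp only [mul_comm]⟩
  choose lam hlam using hlam
  -- `A` itself witnesses that its non-mixed bouquets form a face: D(Gr(T)) ⊆ Gr(A) ⊆ S(A).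
  have hmem : {j | B.IsNonMixed j} ∈ stronglyRobustComplex K T :=
    ⟨m, n, A, B, ⟨hA, hB, rfl⟩, Set.Subset.antisymm (fun u hu => hu.1) fun u hu =>
      ⟨hu, hrobust.graver_subset_indispensable hA (B.D_mem_graver hfree hker hu)⟩⟩
  have hmixed : ∀ j, ¬ B.IsNonMixed j → ∃ a, B.c j a < 0 := by
    intro j hj
    rw [B.isNonMixed_iff (hfree j)] at hj
    push Not at hj
    obtain ⟨a, ha⟩ := hj
    exact ⟨a, lt_of_le_of_ne ha (B.c_ne_zero j a)⟩
  have hempty := empty_mem_stronglyRobustComplex (K := K) hs hT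
  refine ⟨B.r, B.c, lam, B.e, B.c_ne_zero, hgcd, hlam, ?_, hpos, ?_⟩
  · refine toricIdeal_congr fun w => ?_
    rw [generalizedLawrence_mulVec_eq_zero_iff T hlam fun j => (hpos j).ne']
    constructor
    · intro hw
      obtain ⟨u, hu, huw⟩ := B.exists_eq_D hfree hw
      exact ⟨u, (hker u).1 hu, huw⟩
    · rintro ⟨u, hu, rfl⟩
      exact (B.mulVec_D u).trans ((hker u).2 hu)
  -- The two alternatives depend on whether Δ_T has a vertex. Any non-mixed bouquet of `A` is a
  -- vertex, hence the only one.
  by_cases hex : ∃ ω ∈ stronglyRobustComplex K T, ω.Nonempty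
  · obtain ⟨ω, hω, i, hi⟩ := hex
    have heq : ∀ ω' ∈ stronglyRobustComplex K T, ∀ j ∈ ω', j = i := fun ω' hω' j hj =>
      eq_of_mem_stronglyRobustComplex hs hN hTN hω' hω hj hi
    have hωi : ω = {i} := Set.eq_singleton_iff_unique_mem.2 ⟨hi, heq ω hω⟩
    refine Or.inr ⟨i, Set.Subset.antisymm (fun ω' hω' => ?_) ?_,
      fun j hj => hmixed j fun h => hj (heq _ hmem j h)⟩
    · exact Set.subset_singleton_iff_eq.1 (heq ω' hω')
    · rintro ω' (rfl | rfl)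
      · exact hempty
      · exact hωi ▸ hω
  · push Not at hex
    refine Or.inl ⟨Set.Subset.antisymm (fun ω' hω' => hex ω' hω')
      (Set.singleton_subset_iff.2 hempty), fun j => hmixed j fun h => ?_⟩
    exact Set.eq_empty_iff_forall_notMem.1 (hex _ hmem) j h
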